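/- Let $p$ be an odd prime, $\zeta_p$ a primitive $p$-th root of unity, $K=\mathbb{Q}(\zeta_p)$, $K^+$ its maximal totally real subfield and $\pi=(\zeta_p-1)\mathbb{Z}[\zeta_p]$. Suppose that $p$ divides the class number of $K$ (that is, $p$ is irregular) but not that of $K^+$. Let $v$ be a primitive root modulo $p$, let $\sigma\in\mathrm{Gal}(K/\mathbb{Q})$ be given by $\sigma(\zeta_p)=\zeta_p^{\,v}$, and put $$P(\sigma)=\sum_{i=0}^{p-2}v_{i}\,\sigma^i\in\mathbb{Z}[\mathrm{Gal}(K/\mathbb{Q})],\qquad 1\le v_i\le p-1,\quad v_i\equiv v^{-i}\pmod p .$$ For $x\in K^\times$ write $x^{\sum_g n_g g}=\prod_g g(x)^{n_g}$. Let $\Gamma$ be a subgroup of order $p$ of the $p$-class group of $K$ which is annihilated by $\sigma-\mu$, i.e. $\sigma(c)=c^{\mu}$ for all $c\in\Gamma$, where $\mu\in\mathbb{F}_p^*$ and $\mu\equiv v^{2m+1}\pmod p$ with $1\le m\le\frac{p-3}{2}$. Let $q\equiv 1\pmod p$ be a prime number and let $\mathbf q$ be a prime ideal of $\mathbb{Z}[\zeta_p]$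 over $q$, with $N\mathbf q=q$ and with class in $\Gamma$. Let $A\in\mathbb{Z}[\zeta_p]$ be a singular integer with $A\,\mathbb{Z}[\zeta_p]=\mathbf q^p$, that is, $A$ is moreover not a $p$-th power in $K$, and suppose that $\sigma(A)=A^{\mu}\alpha^p$ for some $\alpha\in K$ and that $\pi^{2m+1}$ divides $A-1$ exactly. Let $\zeta_q$ be a primitive $q$-th root of unity and let $$g(\mathbf q)=\sum_{x\in\mathbb{F}}\chi(x)\,\zeta_q^{\mathrm{Tr}_{\mathbb{F}/\mathbb{F}_q}(x)}\in\mathbb{Q}(\zeta_p,\zeta_q),\qquad \mathbb{F}=\mathbb{Z}[\zeta_p]/\mathbf q,$$ where $\chi(0)=0$ and, for $\alpha\notin\mathbf q$, $\chi(\alpha\bmod\mathbf q)=\left\{\frac{\alpha}{\mathbf q}\right\}_p^{-1}$, the inverse of the $p$-th power residue symbol: $\left\{\frac{\alpha}{\mathbf q}\right\}_p$ is the $p$-th root of unity congruent to $\alpha^{(N\mathbf q-1)/p}$ modulo $\mathbf q$. Then there is $D\in O_{K^+}$ with $A\overline{A}=D^p$, and for every such $D$ $$\left(\frac{g(\mathbf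 q)}{\overline{g(\mathbf q)}}\right)^{p^2}=\left(\frac{A^2}{D^p}\right)^{P(\sigma)},$$ where the bar denotes complex conjugation. -/

import Mathlib

open NumberField

open scoped nonZeroDivisors

noncomputable section

namespace StickelbergerSingular

/-- Complex conjugation on a field generated over `ℚ` by roots of unity, at least one of which has
order `> 2` (such a field is a CM field). -/
def conj (S : Set ℕ) (hS : ∃ n ∈ S, 2 < n) (K : Type*) [Field K] [NumberField K]
    [IsCyclotomicExtension S ℚ K] : K ≃ₐ[maximalRealSubfield K] K :=
  haveI : IsCMField K := IsCyclotomicExtension.Rat.isCMField K hS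
  IsCMField.complexConj K

section Galois

variable {K : Type*} [Field K]

/-- The element `P(σ) = ∑_{i=0}^{p-2} v^{-i} σ^i` of the group ring `ℤ[Gal(K/ℚ)]`, where `v^{-i}`
stands for its representative modulo `p` in `{1, …, p - 1}`. -/
def stickelbergerP [CharZero K] (p v : ℕ) (σ : K ≃ₐ[ℚ] K) : MonoidAlgebra ℤ (K ≃ₐ[ℚ] K) :=
  ∑ i ∈ Finset.range (p - 1), MonoidAlgebra.single (σ ^ i) ((((v : ZMod p)⁻¹ ^ i).val : ℕ) : ℤ)

/-- The exponential action of the group ring: `x ^ (∑ n_g g) = ∏ g(x) ^ n_g`. -/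
def groupRingPow [CharZero K] (x : K) (Q : MonoidAlgebra ℤ (K ≃ₐ[ℚ] K)) : K :=
  Q.coeff.prod fun g n => (g x) ^ n

/-- The image `σ(I)` of a nonzero ideal `I` of the ring of integers. -/
def galIdeal [CharZero K] (σ : K ≃ₐ[ℚ] K) (I : (Ideal (𝓞 K))⁰) : (Ideal (𝓞 K))⁰ :=
  ⟨(I : Ideal (𝓞 K)).map (RingOfIntegers.mapRingEquiv (σ : K ≃+* K)), by
    have hI : (I : Ideal (𝓞 K)) ≠ ⊥ := mem_nonZeroDivisors_iff_ne_zero.mp I.2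
    exact mem_nonZeroDivisors_iff_ne_zero.mpr fun h =>
      hI ((Ideal.map_eq_bot_iff_of_injective
        (RingOfIntegers.mapRingEquiv (σ : K ≃+* K)).injective).mp h)⟩

/-- The subgroup `Γ` of the class group is annihilated by `σ - μ`, that is, `σ(c) = c ^ μ` for every
class `c` in `Γ`. -/
def AnnihilatedBy [NumberField K] {p : ℕ} (σ : K ≃ₐ[ℚ] K) (μ : ZMod p)
    (Γ : Subgroup (ClassGroup (𝓞 K))) : Prop :=
  ∀ I : (Ideal (𝓞 K))⁰, ClassGroup.mk0 I ∈ Γ →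
    ClassGroup.mk0 (galIdeal σ I) = ClassGroup.mk0 I ^ μ.val

/-- `A` is singular: it is not a `p`-th power in `K`, but it generates the `p`-th power of an
ideal. -/
def IsSingular [CharZero K] (p : ℕ) (A : 𝓞 K) : Prop :=
  (¬ ∃ x : K, x ^ p = (A : K)) ∧ ∃ I : Ideal (𝓞 K), Ideal.span {A} = I ^ p

end Galois

section Gauss

variable {K : Type*} [Field K] [NumberField K]

open Classical in
/-- The `p`-th power residue symbol `{α / 𝔮}_p` of the class `x` of `α` modulo the prime ideal `𝔮`:
the `p`-th root of unity `ζ ^ c` with `α ^ ((N𝔮 - 1) / p) ≡ ζ ^ c` modulo `𝔮` if `x ≠ 0`, and `0` if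
`x = 0`. -/
def powerResidue (p : ℕ) (ζ : 𝓞 K) (𝔮 : Ideal (𝓞 K)) (x : 𝓞 K ⧸ 𝔮) : 𝓞 K :=
  if h : x ≠ 0 ∧ ∃ c : ℕ,
      x ^ ((Ideal.absNorm 𝔮 - 1) / p) = Ideal.Quotient.mk 𝔮 (ζ ^ c) then
    ζ ^ Nat.find h.2
  else 0

/-- The absolute trace of the residue field `𝓞 K ⧸ 𝔮`, with values in `ZMod q`, where `𝔮` lies over
the prime number `q`. -/
def residueTrace (q : ℕ) (𝔮 : Ideal (𝓞 K)) [𝔮.LiesOver (Ideal.span {(q : ℤ)})]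
    (x : 𝓞 K ⧸ 𝔮) : ZMod q :=
  Int.quotientSpanNatEquivZMod q (Algebra.trace (ℤ ⧸ Ideal.span {(q : ℤ)}) (𝓞 K ⧸ 𝔮) x)

/-- The Gauss sum `g(𝔮) = ∑ x, χ(x) ζ_q ^ Tr(x)`, where `x` runs over the residue field of `𝔮` and
`χ(x)` is the inverse of the `p`-th power residue symbol (with `χ(0) = 0`). It is an element of a
field `L` containing `K` and the `q`-th root of unity `ζq`. -/
def gaussSumAt (p q : ℕ) (ζ : 𝓞 K) {L : Type*} [Field L] [Algebra K L] (ζq : L)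
    (𝔮 : Ideal (𝓞 K)) [𝔮.LiesOver (Ideal.span {(q : ℤ)})] : L :=
  ∑ᶠ x : 𝓞 K ⧸ 𝔮,
    (algebraMap K L (powerResidue p ζ 𝔮 x : K))⁻¹ * ζq ^ (residueTrace q 𝔮 x).val

end Gauss

end StickelbergerSingular

end

noncomputable section

namespace StickelbergerSingular

/-! ### Jacobi sums under reduction -/

section Characters

variable {F R S : Type*} [Field F] [Fintype F] [CommRing R] [CommRing S]

/-! The `p`-th power of `g(𝔮)` is an integer `G` of `K`, a product of Jacobi sums (`jacobiProd`).
Stickelberger's factorization gives `G ^ p = u * A ^ P(σ)` with `u` a unit. If `u` is real, dividing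
by the complex conjugate cancels it and leaves `(A / Ā) ^ P(σ)`, and `A / Ā = A ^ 2 / D ^ p` because
`A Ā = D ^ p`.

Only the divisibility half of Stickelberger is needed. Enough Jacobi sums vanish modulo `𝔮` that
each conjugate `σ^i(A) ^ v_i` divides `G ^ p` (`pow_dvd_jacobiProd_pow`). These conjugates are
pairwise coprime, and `g ḡ = q` shows that both sides have the same norm, so the cofactor is a unit
(`exists_unit_jacobiProd_pow`).

To see that `u` is real, work modulo powers of `π`. Characters of order `p` are trivial modulo `π`,
so `G ≡ -1` modulo `π` and `G ^ p ≡ -1` modulo `π ^ 2`. Since `A ≡ 1` modulo `π ^ 2`, also `u ≡ -1`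
modulo `π ^ 2`. Then `u / ū` is a root of unity congruent to `1` modulo `π ^ 2`, hence equal to `1`
(`conjInt_eq_self_of_add_one_mem`).

For the existence of `D`, put `B = A Ā`. Iterating `σ(B) = B ^ μ β ^ p` up to complex conjugation `σ
^ ((p - 1) / 2)` makes `B ^ 2` a `p`-th power, because `μ` is an odd power of `v`
(`exists_mul_conj_eq_pow`). -/

theorem sum_pow_mul_one_sub_pow_eq_zero (a b : ℕ) (hab : a + b < Fintype.card F - 1) :
    ∑ x : F, x ^ a * (1 - x) ^ b = 0 := by
  have h : ∀ x : F, x ^ a * (1 - x) ^ b =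
      ∑ k ∈ Finset.range (b + 1), ((-1) ^ k * (b.choose k : F)) * x ^ (a + k) := by
    intro x
    rw [sub_eq_neg_add, add_pow, Finset.mul_sum]
    refine Finset.sum_congr rfl fun k _ => ?_
    rw [neg_pow, pow_add]
    ring
  simp_rw [h]
  rw [Finset.sum_comm]
  refine Finset.sum_eq_zero fun k hk => ?_
  -- After binomial expansion every exponent is below `#F - 1`, so each power sum over `F` vanishes.
  rw [← Finset.mul_sum, FiniteField.sum_pow_lt_card_sub_one, mul_zero]
  have := Finset.mem_range.mp hk
  omega

/-- A Jacobi sum of small powers of a character lifting `x ↦ x ^ d` reduces to zero. -/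
theorem map_jacobiSum_pow_eq_zero (r : R →+* F) (χ : MulChar F R) {d : ℕ}
    (hχ : ∀ x, r (χ x) = x ^ d) {a b : ℕ} (ha : a ≠ 0) (hb : b ≠ 0)
    (hab : (a + b) * d < Fintype.card F - 1) : r (jacobiSum (χ ^ a) (χ ^ b)) = 0 := by
  rw [jacobiSum, map_sum, ← sum_pow_mul_one_sub_pow_eq_zero (F := F) (a * d) (b * d)
    (by rwa [← add_mul])]
  refine Finset.sum_congr rfl fun x _ => ?_
  rw [MulChar.pow_apply' χ ha, MulChar.pow_apply' χ hb, map_mul, map_pow, map_pow, hχ, hχ]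
  ring

/-- Both characters become trivial after `f`. Used modulo `π`, where every `p`-th root of unity is
`1`. -/
theorem map_jacobiSum_eq_of_map_eq_one (f : R →+* S) (χ φ : MulChar F R)
    (hχ : ∀ x, x ≠ 0 → f (χ x) = 1) (hφ : ∀ x, x ≠ 0 → f (φ x) = 1) :
    f (jacobiSum χ φ) = Fintype.card F - 2 := by
  have h : ∀ χ : MulChar F R, (∀ x, x ≠ 0 → f (χ x) = 1) → χ.ringHomComp f = 1 := by
    intro χ h
    ext x
    rw [MulChar.ringHomComp_apply, h x x.ne_zero, MulChar.one_apply_coe]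
  rw [← jacobiSum_ringHomComp, h χ hχ, h φ hφ, jacobiSum_one_one]

end Characters

/-! ### Counting residues modulo `p` -/

section Counting

/-- At least `t - 1` of the residues `1 ≤ k < p - 1` satisfy `0 < -t k mod p < t`. -/
theorem le_card_filter_neg_mul_val_lt (p : ℕ) [Fact p.Prime] {t : ℕ} (ht : 0 < t) (htp : t < p) :
    t - 1 ≤ ((Finset.Ico 1 (p - 1)).filter fun k : ℕ =>
      (-((t : ZMod p) * k)).val ≠ 0 ∧ (-((t : ZMod p) * k)).val < t).card := by
  have ht0 : (t : ZMod p) ≠ 0 := by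
    rw [Ne, ZMod.natCast_eq_zero_iff]
    exact Nat.not_dvd_of_pos_of_lt ht htp
  have hinv : ∀ u : ℕ, (t : ZMod p) * (-((u : ZMod p) / t)) = -u := by
    intro u
    field_simp
  rw [← Nat.card_Ico 1 t]
  have hinj : Set.InjOn (fun u : ℕ => (-((u : ZMod p) / (t : ZMod p))).val) (Finset.Ico 1 t) := by
    intro u hu u' hu' h
    have h1 := ZMod.val_injective p h
    rw [neg_inj, div_left_inj' ht0] at h1
    have h2 := congrArg ZMod.val h1
    rwa [ZMod.val_natCast_of_lt ((Finset.mem_Ico.mp hu).2.trans htp),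
      ZMod.val_natCast_of_lt ((Finset.mem_Ico.mp hu').2.trans htp)] at h2
  -- Each `u` in `1, …, t - 1` is the value of `-t k` at `k = -u / t`.
  refine Finset.card_le_card_of_injOn _ (fun u hu => ?_) hinj
  obtain ⟨hu1, hut⟩ := Finset.mem_Ico.mp hu
  have hu0 : (u : ZMod p) ≠ 0 := by
    rw [Ne, ZMod.natCast_eq_zero_iff]
    exact Nat.not_dvd_of_pos_of_lt hu1 (hut.trans htp)
  have hlt := ZMod.val_lt (-((u : ZMod p) / (t : ZMod p)))
  have hne : (-((u : ZMod p) / (t : ZMod p))).val ≠ 0 := by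
    rw [Ne, ZMod.val_eq_zero, neg_eq_zero, div_eq_zero_iff]
    tauto
  -- The index `k = p - 1` is outside the range, but it would force `u = t`.
  have hne' : (-((u : ZMod p) / (t : ZMod p))).val ≠ p - 1 := by
    intro h
    have h1 := congrArg (Nat.cast : ℕ → ZMod p) h
    rw [ZMod.natCast_zmod_val, Nat.cast_sub (Fact.out : p.Prime).one_le, ZMod.natCast_self,
      Nat.cast_one, zero_sub, neg_inj, div_eq_one_iff_eq ht0] at h1
    have h2 := congrArg ZMod.val h1
    rw [ZMod.val_natCast_of_lt (hut.trans htp), ZMod.val_natCast_of_lt htp] at h2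
    omega
  simp only [Finset.coe_filter, Finset.mem_Ico, Set.mem_ofPred_eq, ZMod.natCast_zmod_val, hinv,
    neg_neg, ZMod.val_natCast_of_lt (hut.trans htp)]
  omega

/-- The powers of `w` run once through `1, …, p - 1`. This is the degree of the Stickelberger
element, needed for the norm comparison. -/
theorem two_mul_sum_val_pow (p : ℕ) [Fact p.Prime] {w : ZMod p} (hw : IsPrimitiveRoot w (p - 1)) :
    2 * ∑ i ∈ Finset.range (p - 1), (w ^ i).val = p * (p - 1) := by
  classical
  have hp : 1 < p := (Fact.out : p.Prime).one_lt
  have hinj : Set.InjOn (fun i => (w ^ i).val) (Finset.range (p - 1)) := by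
    intro i hi j hj h
    exact hw.pow_inj (Finset.mem_range.mp hi) (Finset.mem_range.mp hj) (ZMod.val_injective p h)
  have himg : (Finset.range (p - 1)).image (fun i => (w ^ i).val) = Finset.Ico 1 p := by
    apply Finset.eq_of_subset_of_card_le
    · intro x hx
      obtain ⟨i, -, rfl⟩ := Finset.mem_image.mp hx
      refine Finset.mem_Ico.mpr ⟨Nat.one_le_iff_ne_zero.mpr ?_, ZMod.val_lt _⟩
      rw [Ne, ZMod.val_eq_zero]
      exact pow_ne_zero _ (hw.ne_zero (by omega))
    · rw [Finset.card_image_of_injOn hinj, Nat.card_Ico, Finset.card_range]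
  rw [← Finset.sum_image (f := fun x => x) hinj, himg, ← Finset.sum_range_id_mul_two,
    Finset.range_eq_Ico, Finset.sum_eq_sum_Ico_succ_bot (a := 0) (by omega), zero_add, zero_add,
    mul_comm]

end Counting

/-! ### The `p`-th power of a Gauss sum as a product of Jacobi sums -/

section JacobiProduct

variable {F R S : Type*} [Field F] [Fintype F] [CommRing R] [CommRing S]

/-- The product of Jacobi sums that is equal to the `n`-th power of the Gauss sum of a character
of order `n`. -/
def jacobiProd (n : ℕ) (φ : MulChar F R) : R :=
  φ (-1) * Fintype.card F * ∏ k ∈ Finset.Ico 1 (n - 1), jacobiSum φ (φ ^ k)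

theorem map_jacobiProd (f : R →+* S) (n : ℕ) (φ : MulChar F R) :
    f (jacobiProd n φ) = jacobiProd n (φ.ringHomComp f) := by
  simp only [jacobiProd, map_mul, map_natCast, map_prod, MulChar.ringHomComp_apply,
    MulChar.ringHomComp_pow, jacobiSum_ringHomComp]

theorem gaussSum_pow_eq_map_jacobiProd [IsDomain S] {f : R →+* S} (hf : Function.Injective f)
    {n : ℕ} (hn : 2 ≤ n) {φ : MulChar F R} (hφ : orderOf φ = n) {ψ : AddChar F S}
    (hψ : ψ.IsPrimitive) : gaussSum (φ.ringHomComp f) ψ ^ n = f (jacobiProd n φ) := by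
  have h : orderOf (φ.ringHomComp f) = n := by
    rw [← hφ]
    exact orderOf_injective (MulChar.ringHomCompHom f) (MulChar.injective_ringHomComp hf) φ
  rw [map_jacobiProd, jacobiProd, ← h]
  exact gaussSum_pow_eq_prod_jacobiSum (h.symm ▸ hn) hψ

theorem map_jacobiProd_eq_neg_one (f : R →+* S) {n : ℕ} (hn : Odd n) (hn2 : 2 < n)
    {φ : MulChar F R} (hφ : ∀ x, x ≠ 0 → f (φ x) = 1) (hF : (Fintype.card F : S) = 1) :
    f (jacobiProd n φ) = -1 := by
  have hJ : ∀ k ∈ Finset.Ico 1 (n - 1), f (jacobiSum φ (φ ^ k)) = -1 := by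
    intro k hk
    rw [map_jacobiSum_eq_of_map_eq_one f φ (φ ^ k) hφ, hF]
    · ring
    · intro x hx
      have hk0 : k ≠ 0 := by
        have := (Finset.mem_Ico.mp hk).1
        omega
      rw [MulChar.pow_apply' φ hk0, map_pow, hφ x hx, one_pow]
  rw [jacobiProd, map_mul, map_mul, map_natCast, hF, hφ _ (neg_ne_zero.mpr one_ne_zero), map_prod,
    Finset.prod_congr rfl hJ, Finset.prod_const, Nat.card_Ico, one_mul, one_mul]
  -- There are `n - 2` Jacobi sums, an odd number.
  refine Odd.neg_one_pow ?_
  obtain ⟨k, rfl⟩ := hn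
  exact ⟨k - 1, by omega⟩

theorem inv_pow_eq_pow_val_neg {G : Type*} [Group G] (p : ℕ) [NeZero p] {g : G} (hg : g ^ p = 1)
    (n : ℕ) : g⁻¹ ^ n = g ^ (-(n : ZMod p)).val := by
  have h : p ∣ n + (-(n : ZMod p)).val := by
    rw [← ZMod.natCast_eq_zero_iff]
    simp
  obtain ⟨c, hc⟩ := h
  rw [inv_pow, inv_eq_iff_mul_eq_one, ← pow_add, hc, pow_mul, hg, one_pow]

/-- The divisibility half of Stickelberger's congruence. -/
theorem jacobiProd_inv_pow_mem (p : ℕ) [Fact p.Prime] (r : R →+* F) {χ : MulChar F R} {d : ℕ}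
    (hχ : ∀ x, r (χ x) = x ^ d) (hχp : χ ^ p = 1) (hd : 0 < d) (hpd : p * d = Fintype.card F - 1)
    {t : ℕ} (ht : 0 < t) (htp : t < p) : jacobiProd p (χ⁻¹ ^ t) ∈ RingHom.ker r ^ t := by
  set s := (Finset.Ico 1 (p - 1)).filter fun k : ℕ =>
      (-((t : ZMod p) * k)).val ≠ 0 ∧ (-((t : ZMod p) * k)).val < t
  have hs : ∏ k ∈ s, jacobiSum (χ⁻¹ ^ t) ((χ⁻¹ ^ t) ^ k) ∈ RingHom.ker r ^ s.card := by
    rw [← Finset.prod_const]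
    refine Ideal.prod_mem_prod fun k hk => ?_
    obtain ⟨-, hk0, hkt⟩ := Finset.mem_filter.mp hk
    have h1 : χ⁻¹ ^ t = χ ^ (p - t) := by
      rw [inv_pow, inv_eq_iff_mul_eq_one, ← pow_add, Nat.add_sub_cancel' htp.le, hχp]
    rw [← pow_mul, inv_pow_eq_pow_val_neg p hχp (t * k), h1, Nat.cast_mul, RingHom.mem_ker]
    -- The two characters are `χ ^ (p - t)` and `χ ^ b` with `0 < b < t`, so the exponents add up to
    -- less than `p`.
    refine map_jacobiSum_pow_eq_zero r χ hχ (by omega) hk0 ?_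
    rw [← hpd]
    exact Nat.mul_lt_mul_of_pos_right (by omega) hd
  have hq : (Fintype.card F : R) ∈ RingHom.ker r := by
    rw [RingHom.mem_ker, map_natCast, Nat.cast_card_eq_zero]
  -- The counting gives `t - 1` vanishing Jacobi sums; the factor `#F` supplies the missing one.
  have hle : t ≤ 1 + s.card := by
    have := le_card_filter_neg_mul_val_lt p ht htp
    change t - 1 ≤ s.card at this
    omega
  refine Ideal.pow_le_pow_right hle ?_
  rw [jacobiProd, ← Finset.prod_filter_mul_prod_filter_not _ fun k : ℕ =>
      (-((t : ZMod p) * k)).val ≠ 0 ∧ (-((t : ZMod p) * k)).val < t, mul_assoc, pow_add, pow_one]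
  exact Ideal.mul_mem_left _ _ (Ideal.mul_mem_mul hq (Ideal.mul_mem_right _ _ hs))

end JacobiProduct

/-! ### The power residue character -/

section ResidueCharacter

theorem pow_eq_pow_iff_natCast_eq {M : Type*} [CommMonoid M] {ζ : M} {p : ℕ} [NeZero p]
    (hζ : IsPrimitiveRoot ζ p) {a b : ℕ} : ζ ^ a = ζ ^ b ↔ (a : ZMod p) = b := by
  have hfin : IsOfFinOrder ζ :=
    isOfFinOrder_iff_pow_eq_one.mpr ⟨p, NeZero.pos p, hζ.pow_eq_one⟩
  rw [hfin.pow_eq_pow_iff_modEq, ← hζ.eq_orderOf, ZMod.natCast_eq_natCast_iff]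

variable {F R : Type*} [Field F] [CommRing R]

/-- Reduction is injective on `p`-th roots of unity, so identities between them can be checked in
the residue field. -/
theorem pow_eq_pow_of_map_eq {R S : Type*} [CommRing R] [CommRing S] (r : R →+* S) {ζ : R} {p : ℕ}
    [NeZero p] (hζ : IsPrimitiveRoot ζ p) (hrζ : IsPrimitiveRoot (r ζ) p) {a b : ℕ}
    (h : r ζ ^ a = r ζ ^ b) : ζ ^ a = ζ ^ b := by
  rw [pow_eq_pow_iff_natCast_eq hrζ] at h
  rwa [pow_eq_pow_iff_natCast_eq hζ]

/-- The power residue character of a finite residue field, lifted to roots of unity. -/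
theorem exists_residueChar [Fintype F] [Nontrivial R] (r : R →+* F) {ζ : R} {p d : ℕ} [NeZero p]
    (hζ : IsPrimitiveRoot ζ p)
    (hrζ : IsPrimitiveRoot (r ζ) p) (hd : 0 < d) (hpd : p * d = Fintype.card F - 1) :
    ∃ χ : MulChar F R, (∀ x, r (χ x) = x ^ d) ∧ ∀ x, x ≠ 0 → ∃ c : ℕ, χ x = ζ ^ c := by
  classical
  have hex : ∀ x : F, ∃ c : ℕ, x ≠ 0 → r ζ ^ c = x ^ d := by
    intro x
    by_cases hx : x = 0
    · exact ⟨0, fun h => absurd hx h⟩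
    · obtain ⟨c, -, hc⟩ := hrζ.eq_pow_of_pow_eq_one (ξ := x ^ d)
        (by rw [← pow_mul, mul_comm, hpd, FiniteField.pow_card_sub_one_eq_one x hx])
      exact ⟨c, fun _ => hc⟩
  choose c hc using hex
  refine ⟨{ toFun := fun x => if x = 0 then 0 else ζ ^ c x
            map_one' := ?_
            map_mul' := ?_
            map_nonunit' := ?_ }, ?_, ?_⟩
  · rw [if_neg one_ne_zero, ← pow_zero ζ]
    exact pow_eq_pow_of_map_eq r hζ hrζ (by rw [hc 1 one_ne_zero, one_pow, pow_zero])
  · intro x y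
    by_cases hx : x = 0
    · simp [hx]
    by_cases hy : y = 0
    · simp [hy]
    simp only [mul_eq_zero, hx, hy, or_self, if_false, ← pow_add]
    exact pow_eq_pow_of_map_eq r hζ hrζ (by
      rw [hc _ (mul_ne_zero hx hy), pow_add, hc x hx, hc y hy, mul_pow])
  · intro x hx
    exact if_pos (not_not.mp fun h => hx (isUnit_iff_ne_zero.mpr h))
  · intro x
    change r (if x = 0 then 0 else ζ ^ c x) = x ^ d
    by_cases hx : x = 0
    · simp [hx, hd.ne']
    · rw [if_neg hx, map_pow, hc x hx]
  · intro x hx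
    exact ⟨c x, if_neg hx⟩

theorem residueChar_pow_eq_one {χ : MulChar F R} {ζ : R} {p : ℕ} (hζ : IsPrimitiveRoot ζ p)
    (hχ : ∀ x, x ≠ 0 → ∃ c : ℕ, χ x = ζ ^ c) : χ ^ p = 1 := by
  ext x
  obtain ⟨c, hc⟩ := hχ x x.ne_zero
  rw [MulChar.pow_apply_coe, hc, MulChar.one_apply_coe, ← pow_mul, mul_comm, pow_mul,
    hζ.pow_eq_one, one_pow]

theorem orderOf_residueChar_inv [Fintype F] (r : R →+* F) {χ : MulChar F R} {p d : ℕ} [Fact p.Prime]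
    (hχ : ∀ x, r (χ x) = x ^ d) (hχp : χ ^ p = 1) (hd : 0 < d)
    (hpd : p * d = Fintype.card F - 1) : orderOf χ⁻¹ = p := by
  rw [orderOf_inv]
  refine orderOf_eq_prime hχp fun h => ?_
  have h1 : ∀ x : Fˣ, x ^ d = 1 := by
    intro x
    ext
    rw [Units.val_pow_eq_pow_val, ← hχ, h, MulChar.one_apply_coe, map_one, Units.val_one]
  -- A trivial `χ` would force `#F - 1 = p d` to divide `d`.
  have h2 := (FiniteField.forall_pow_eq_one_iff F d).mp h1
  rw [← hpd] at h2
  have h3 := Nat.le_of_dvd hd h2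
  have h4 := (Fact.out : p.Prime).one_lt
  nlinarith

theorem residueChar_inv_ringHomComp {χ : MulChar F R} {ζ : R}
    (hχ : ∀ x, x ≠ 0 → ∃ c : ℕ, χ x = ζ ^ c) (τ : R →+* R) {t : ℕ} (hτ : τ ζ = ζ ^ t) :
    χ⁻¹.ringHomComp τ = χ⁻¹ ^ t := by
  rw [← MulChar.ringHomComp_inv, inv_pow]
  congr 1
  ext x
  obtain ⟨c, hc⟩ := hχ x x.ne_zero
  rw [MulChar.ringHomComp_apply, MulChar.pow_apply_coe, hc, map_pow, hτ, ← pow_mul, ← pow_mul,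
    mul_comm]

theorem residueChar_inv_apply {χ : MulChar F R} {ζ : R}
    (hχ : ∀ x, x ≠ 0 → ∃ c : ℕ, χ x = ζ ^ c) (x : F) (hx : x ≠ 0) : ∃ c : ℕ, χ⁻¹ x = ζ ^ c := by
  rw [MulChar.inv_apply']
  exact hχ _ (inv_ne_zero hx)

end ResidueCharacter

/-! ### Norms and coprimality of conjugates -/

section Units

variable {K : Type*} [Field K] [NumberField K]

theorem absNorm_span_ringEquiv (τ : 𝓞 K ≃+* 𝓞 K) (x : 𝓞 K) :
    Ideal.absNorm (Ideal.span {τ x}) = Ideal.absNorm (Ideal.span {x}) := by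
  rw [Ideal.absNorm_span_singleton, Ideal.absNorm_span_singleton]
  congr 1
  exact Algebra.norm_eq_of_algEquiv τ.toIntAlgEquiv x

theorem absNorm_span_mul (x y : 𝓞 K) : Ideal.absNorm (Ideal.span {x * y}) =
    Ideal.absNorm (Ideal.span {x}) * Ideal.absNorm (Ideal.span {y}) := by
  rw [← Ideal.span_singleton_mul_span_singleton, map_mul]

theorem absNorm_span_pow (x : 𝓞 K) (n : ℕ) : Ideal.absNorm (Ideal.span {x ^ n}) =
    Ideal.absNorm (Ideal.span {x}) ^ n := by
  rw [← Ideal.span_singleton_pow, map_pow]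

theorem absNorm_span_natCast (n : ℕ) :
    Ideal.absNorm (Ideal.span {(n : 𝓞 K)}) = n ^ Module.finrank ℚ K := by
  rw [Ideal.absNorm_span_singleton, ← map_natCast (algebraMap ℤ (𝓞 K)), Algebra.norm_algebraMap,
    RingOfIntegers.rank, Int.natAbs_pow, Int.natAbs_natCast]

theorem exists_natCast_sub_mem {q : ℕ} (hq : q.Prime) {𝔮 : Ideal (𝓞 K)}
    (hN : Ideal.absNorm 𝔮 = q) (x : 𝓞 K) : ∃ n : ℕ, x - n ∈ 𝔮 := by
  have hcard : Nat.card (𝓞 K ⧸ 𝔮) = q := by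
    rw [← hN, Ideal.absNorm_apply]
    rfl
  have : Finite (𝓞 K ⧸ 𝔮) := Nat.finite_of_card_ne_zero (hcard ▸ hq.ne_zero)
  have := Fintype.ofFinite (𝓞 K ⧸ 𝔮)
  have : NeZero q := ⟨hq.ne_zero⟩
  let e := ZMod.ringEquivOfPrime (𝓞 K ⧸ 𝔮) hq (by rw [← Nat.card_eq_fintype_card, hcard])
  refine ⟨(e.symm (Ideal.Quotient.mk 𝔮 x)).val, ?_⟩
  rw [← Ideal.Quotient.eq, map_natCast, ← map_natCast e, ZMod.natCast_zmod_val,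
    RingEquiv.apply_symm_apply]

/-- A common maximal ideal would be `𝔮` and make `𝔮` stable under `ρ`. As the residue field is
prime, `ζ ≡ n` modulo `𝔮` for an integer `n`; then `ρ ζ ≡ n ≡ ζ`, and distinct `p`-th roots of unity
stay distinct modulo `𝔮`. -/
theorem isCoprime_of_span_eq_pow {p q : ℕ} (hq : q.Prime) [NeZero p] {ζ : 𝓞 K}
    (hζ : IsPrimitiveRoot ζ p) {𝔮 : Ideal (𝓞 K)} [𝔮.IsMaximal]
    (hN : Ideal.absNorm 𝔮 = q) (hζ𝔮 : IsPrimitiveRoot (Ideal.Quotient.mk 𝔮 ζ) p) {A : 𝓞 K}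
    (hA : Ideal.span {A} = 𝔮 ^ p) (ρ : 𝓞 K ≃+* 𝓞 K) (hρ : ρ ζ ≠ ζ) : IsCoprime A (ρ A) := by
  rw [← Ideal.isCoprime_span_singleton_iff, Ideal.isCoprime_iff_sup_eq]
  by_contra hne
  obtain ⟨M, hM, hle⟩ := Ideal.exists_le_maximal _ hne
  have hMp := hM.isPrime
  have h1 : 𝔮 = M := by
    refine (inferInstance : 𝔮.IsMaximal).eq_of_le hM.ne_top ?_
    exact hMp.le_of_pow_le (hA ▸ le_sup_left.trans hle)
  have h2 : 𝔮 = M.comap ρ := by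
    have hc : (M.comap ρ).IsPrime := Ideal.IsPrime.comap ρ
    refine (inferInstance : 𝔮.IsMaximal).eq_of_le hc.ne_top (hc.le_of_pow_le (n := p) ?_)
    rw [← hA, Ideal.span_singleton_le_iff_mem, Ideal.mem_comap]
    exact hle (le_sup_right (a := Ideal.span {A}) (Ideal.mem_span_singleton_self _))
  obtain ⟨n, hn⟩ := exists_natCast_sub_mem hq hN ζ
  have h3 : ρ ζ - n ∈ 𝔮 := by
    rw [h2, Ideal.mem_comap, map_sub, map_natCast] at hn
    rwa [h1]
  have h4 : Ideal.Quotient.mk 𝔮 (ρ ζ) = Ideal.Quotient.mk 𝔮 ζ := by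
    rw [Ideal.Quotient.eq, ← sub_sub_sub_cancel_right _ _ (n : 𝓞 K)]
    exact sub_mem h3 hn
  obtain ⟨s, -, hs⟩ := hζ.eq_pow_of_pow_eq_one (ξ := ρ ζ)
    (by rw [← map_pow, hζ.pow_eq_one, map_one])
  refine hρ ?_
  rw [← hs, map_pow] at h4
  rw [← hs, pow_eq_pow_of_map_eq (Ideal.Quotient.mk 𝔮) hζ hζ𝔮 (b := 1) (by rw [h4, pow_one]),
    pow_one]

end Units

/-! ### Stickelberger's factorization up to a unit -/

section Stickelberger

variable {K : Type*} [Field K] {F : Type*} [Field F] [Fintype F]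

theorem ringEquiv_symm_apply_root {p v : ℕ} [Fact p.Prime] {ζ : 𝓞 K} (hζ : IsPrimitiveRoot ζ p)
    (hv0 : (v : ZMod p) ≠ 0) {τ : 𝓞 K ≃+* 𝓞 K} {i : ℕ} (hτ : τ ζ = ζ ^ v ^ i) :
    τ.symm ζ = ζ ^ ((v : ZMod p)⁻¹ ^ i).val := by
  rw [RingEquiv.symm_apply_eq, map_pow, hτ, ← pow_mul]
  nth_rw 1 [← pow_one ζ]
  rw [pow_eq_pow_iff_natCast_eq hζ]
  push_cast
  rw [ZMod.natCast_zmod_val, ← mul_pow, mul_inv_cancel₀ hv0, one_pow]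

theorem val_inv_pow_pos {p v : ℕ} [Fact p.Prime] (hv0 : (v : ZMod p) ≠ 0) (i : ℕ) :
    0 < ((v : ZMod p)⁻¹ ^ i).val := by
  rw [Nat.pos_iff_ne_zero, Ne, ZMod.val_eq_zero]
  exact pow_ne_zero _ (inv_ne_zero hv0)

/-- Each conjugate of `𝔮 ^ p = (A)` divides the `p ^ 2`-th power of the Gauss sum to the order
prescribed by the Stickelberger element. -/
theorem pow_dvd_jacobiProd_pow {p v : ℕ} [Fact p.Prime] {ζ : 𝓞 K} (hζ : IsPrimitiveRoot ζ p)
    (hv0 : (v : ZMod p) ≠ 0) {τ : 𝓞 K ≃+* 𝓞 K} {i : ℕ} (hτ : τ ζ = ζ ^ v ^ i)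
    (r : 𝓞 K →+* F) {χ : MulChar F (𝓞 K)} {d : ℕ} (hχ : ∀ x, r (χ x) = x ^ d)
    (hχζ : ∀ x, x ≠ 0 → ∃ c : ℕ, χ x = ζ ^ c) (hd : 0 < d) (hpd : p * d = Fintype.card F - 1)
    {A : 𝓞 K} (hA : Ideal.span {A} = RingHom.ker r ^ p) :
    τ A ^ ((v : ZMod p)⁻¹ ^ i).val ∣ jacobiProd p χ⁻¹ ^ p := by
  have hsymm := ringEquiv_symm_apply_root hζ hv0 hτ
  set t := ((v : ZMod p)⁻¹ ^ i).val with ht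
  have hmem := jacobiProd_inv_pow_mem p r hχ (residueChar_pow_eq_one hζ hχζ) hd hpd
    (ht ▸ val_inv_pow_pos hv0 i) (ht ▸ ZMod.val_lt _)
  -- Divisibility by a conjugate of `𝔮` is moved back to `𝔮`: the inverse of `τ` replaces `χ⁻¹` by
  -- `χ⁻¹ ^ t`, where the bound on `jacobiProd` applies.
  have hG : (τ.symm : 𝓞 K →+* 𝓞 K) (jacobiProd p χ⁻¹) = jacobiProd p (χ⁻¹ ^ t) := by
    rw [map_jacobiProd, residueChar_inv_ringHomComp hχζ (τ.symm : 𝓞 K →+* 𝓞 K) hsymm]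
  rw [← hG] at hmem
  have hdvd : A ^ t ∣ τ.symm (jacobiProd p χ⁻¹) ^ p := by
    rw [← Ideal.mem_span_singleton, ← Ideal.span_singleton_pow, hA, ← pow_mul, mul_comm, pow_mul]
    exact Ideal.pow_mem_pow hmem p
  simpa using map_dvd τ hdvd

/-- The prescribed conjugates divide separately and are pairwise coprime, so their product divides;
equality of norms then makes the cofactor a unit. -/
theorem exists_unit_jacobiProd_pow [NumberField K] {p v : ℕ} [Fact p.Prime] (hp : 2 < p)
    [IsCyclotomicExtension {p} ℚ K] {ζ : 𝓞 K} (hζ : IsPrimitiveRoot ζ p)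
    (hv : IsPrimitiveRoot (v : ZMod p) (p - 1)) {τ : ℕ → 𝓞 K ≃+* 𝓞 K}
    (hτ : ∀ i, τ i ζ = ζ ^ v ^ i) {q : ℕ} (hq : q.Prime) (r : 𝓞 K →+* F)
    (hF : Fintype.card F = q) [(RingHom.ker r).IsMaximal] (hN : Ideal.absNorm (RingHom.ker r) = q)
    (hζr : IsPrimitiveRoot (Ideal.Quotient.mk (RingHom.ker r) ζ) p)
    {χ : MulChar F (𝓞 K)} {d : ℕ} (hχ : ∀ x, r (χ x) = x ^ d)
    (hχζ : ∀ x, x ≠ 0 → ∃ c : ℕ, χ x = ζ ^ c) (hd : 0 < d) (hpd : p * d = q - 1)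
    {A : 𝓞 K} (hA : Ideal.span {A} = RingHom.ker r ^ p) (c : 𝓞 K ≃+* 𝓞 K)
    (hc : jacobiProd p χ⁻¹ * c (jacobiProd p χ⁻¹) = (q : 𝓞 K) ^ p) :
    ∃ u : (𝓞 K)ˣ, jacobiProd p χ⁻¹ ^ p =
      (∏ i ∈ Finset.range (p - 1), τ i A ^ ((v : ZMod p)⁻¹ ^ i).val) * u := by
  have hv0 : (v : ZMod p) ≠ 0 := hv.ne_zero (by omega)
  have hdvd : ∏ i ∈ Finset.range (p - 1), τ i A ^ ((v : ZMod p)⁻¹ ^ i).val ∣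
      jacobiProd p χ⁻¹ ^ p := by
    refine Finset.prod_dvd_of_coprime ?_ fun i _ =>
      pow_dvd_jacobiProd_pow hζ hv0 (hτ i) r hχ hχζ hd (hF ▸ hpd) hA
    intro i hi j hj hij
    refine IsCoprime.pow ?_
    have hne : ((τ j).trans (τ i).symm) ζ ≠ ζ := by
      rw [RingEquiv.trans_apply, Ne, RingEquiv.symm_apply_eq, hτ, hτ]
      intro h
      refine hij (hv.pow_inj (Finset.mem_range.mp hi) (Finset.mem_range.mp hj) ?_)
      rw [pow_eq_pow_iff_natCast_eq hζ] at h
      exact_mod_cast h.symm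
    have h := (isCoprime_of_span_eq_pow hq hζ hN hζr hA _ hne).map (τ i : 𝓞 K →+* 𝓞 K)
    simpa using h
  obtain ⟨u, hu⟩ := hdvd
  suffices h : IsUnit u from ⟨h.unit, hu⟩
  have hq0 : 0 < q := hq.pos
  have hNA : Ideal.absNorm (Ideal.span {A}) = q ^ p := by rw [hA, map_pow, hN]
  have hNq : Ideal.absNorm (Ideal.span {(q : 𝓞 K)}) = q ^ (p - 1) := by
    rw [absNorm_span_natCast, IsCyclotomicExtension.finrank K
      (Polynomial.cyclotomic.irreducible_rat (Fact.out : p.Prime).pos),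
      Nat.totient_prime Fact.out]
  -- Norms are squared since `hc` only determines the product of `G` and its conjugate; this also
  -- absorbs the `2` in `two_mul_sum_val_pow`.
  have hNG : Ideal.absNorm (Ideal.span {jacobiProd p χ⁻¹}) ^ 2 = q ^ ((p - 1) * p) := by
    have h := congrArg (fun x => Ideal.absNorm (Ideal.span {x})) hc
    simp only [absNorm_span_mul, absNorm_span_ringEquiv, absNorm_span_pow, hNq] at h
    rw [sq, h, pow_mul]
  have hNa : Ideal.absNorm (Ideal.span
      {∏ i ∈ Finset.range (p - 1), τ i A ^ ((v : ZMod p)⁻¹ ^ i).val}) ^ 2 =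
      q ^ ((p - 1) * p * p) := by
    rw [← Ideal.prod_span_singleton, map_prod]
    simp only [absNorm_span_pow, absNorm_span_ringEquiv, hNA, ← pow_mul]
    rw [Finset.prod_pow_eq_pow_sum, ← pow_mul, ← Finset.mul_sum, mul_assoc,
      mul_comm (∑ i ∈ _, _) 2, two_mul_sum_val_pow p hv.inv]
    congr 1
    ring
  have h := congrArg (fun x => Ideal.absNorm (Ideal.span {x}) ^ 2) hu
  simp only [absNorm_span_mul, absNorm_span_pow, mul_pow, hNa] at h
  rw [← pow_mul, mul_comm p 2, pow_mul, hNG, ← pow_mul] at h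
  have h1 := Nat.eq_of_mul_eq_mul_left (pow_pos hq0 _) ((mul_one _).trans h)
  rw [← Ideal.span_singleton_eq_top, ← Ideal.absNorm_eq_one_iff]
  exact (Nat.pow_eq_one.mp h1.symm).resolve_right two_ne_zero

end Stickelberger

/-! ### Congruences modulo `π ^ 2` -/

section Congruence

variable {K : Type*} [Field K]

theorem ringEquiv_sub_one_mem {ζ : 𝓞 K} (τ : 𝓞 K ≃+* 𝓞 K) {t : ℕ} (hτ : τ ζ = ζ ^ t)
    {n : ℕ} {x : 𝓞 K} (hx : x ∈ Ideal.span {ζ - 1} ^ n) : τ x ∈ Ideal.span {ζ - 1} ^ n := by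
  rw [Ideal.span_singleton_pow, Ideal.mem_span_singleton] at hx ⊢
  refine dvd_trans (pow_dvd_pow_of_dvd ?_ n) (by simpa only [map_pow] using map_dvd τ hx)
  rw [map_sub, hτ, map_one]
  exact sub_one_dvd_pow_sub_one ..

theorem natCast_mem_span_sub_one_sq {p : ℕ} (hp : 2 < p) {ζ : 𝓞 K} (hζ : IsPrimitiveRoot ζ p) :
    (p : 𝓞 K) ∈ Ideal.span {ζ - 1} ^ 2 := by
  obtain ⟨z, -, hz⟩ := hζ.self_sub_one_pow_dvd_order hp
  rw [Ideal.span_singleton_pow, Ideal.mem_span_singleton, hz]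
  exact Dvd.intro_left z rfl

theorem span_sub_one_isPrime_and_ne_bot [NumberField K] {p : ℕ} [Fact p.Prime]
    [IsCyclotomicExtension {p} ℚ K]
    {ζ : 𝓞 K} (hζ : IsPrimitiveRoot ζ p) :
    (Ideal.span {ζ - 1}).IsPrime ∧ Ideal.span {ζ - 1} ≠ ⊥ := by
  have hζ' : IsPrimitiveRoot (ζ : K) p := hζ.map_of_injective RingOfIntegers.coe_injective
  have h := hζ'.zeta_sub_one_prime'
  have h1 : hζ'.toInteger = ζ := rfl
  rw [h1] at h
  refine ⟨(Ideal.span_singleton_prime h.ne_zero).mpr h, ?_⟩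
  rw [Ne, Ideal.span_singleton_eq_bot]
  exact h.ne_zero

/-- If `x ≡ -1` modulo `ζ - 1`, then `x ^ p ≡ -1` modulo `(ζ - 1) ^ 2`. -/
theorem pow_add_one_mem {p : ℕ} (hp : 2 < p) (hodd : Odd p) {ζ : 𝓞 K} (hζ : IsPrimitiveRoot ζ p)
    {x : 𝓞 K} (hx : x + 1 ∈ Ideal.span {ζ - 1}) : x ^ p + 1 ∈ Ideal.span {ζ - 1} ^ 2 := by
  -- In the expansion of `(-1 + (x + 1)) ^ p`, the linear term carries `p`, which lies in `π ^ 2`,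
  -- and the rest carries `(x + 1) ^ 2`.
  obtain ⟨k, hk⟩ := Polynomial.powAddExpansion (-1) (x + 1) p
  rw [neg_add_cancel_comm_assoc, hodd.neg_one_pow] at hk
  rw [hk]
  have h : -1 + (p : 𝓞 K) * (-1) ^ (p - 1) * (x + 1) + k * (x + 1) ^ 2 + 1 =
      (-1) ^ (p - 1) * (x + 1) * p + k * (x + 1) ^ 2 := by ring
  rw [h]
  exact add_mem (Ideal.mul_mem_left _ _ (natCast_mem_span_sub_one_sq hp hζ))
    (Ideal.mul_mem_left _ _ (Ideal.pow_mem_pow hx 2))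

/-- The roots of unity of `K` are `±ζ ^ k`. For `0 < k < p`, `ζ ^ k - 1` is associated to `ζ - 1`,
so it is not in `π ^ 2`; a minus sign would put `2`, hence `1`, in `π`. -/
theorem eq_one_of_isOfFinOrder_of_sub_one_mem [NumberField K] {p : ℕ} [Fact p.Prime] (hp : 2 < p)
    [IsCyclotomicExtension {p} ℚ K] {ζ : 𝓞 K} (hζ : IsPrimitiveRoot ζ p) {w : 𝓞 K}
    (hw : IsOfFinOrder w) (hwπ : w - 1 ∈ Ideal.span {ζ - 1} ^ 2) : w = 1 := by
  have hodd : Odd p := (Fact.out : p.Prime).odd_of_ne_two hp.ne'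
  have hζ' : IsPrimitiveRoot (ζ : K) p := hζ.map_of_injective RingOfIntegers.coe_injective
  obtain ⟨hprime, hbot⟩ := span_sub_one_isPrime_and_ne_bot hζ
  obtain ⟨k, hk, h⟩ := hζ'.exists_pow_or_neg_mul_pow_of_isOfFinOrder hodd
    ((algebraMap (𝓞 K) K : 𝓞 K →* K).isOfFinOrder hw)
  have hζk : ζ ^ k - 1 ∈ Ideal.span {ζ - 1} :=
    Ideal.mem_span_singleton.mpr (sub_one_dvd_pow_sub_one ζ k)
  rcases h with h | h
  · have hwk : w = ζ ^ k := RingOfIntegers.coe_injective (by rw [map_pow]; exact h)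
    by_cases hk0 : k = 0
    · rw [hwk, hk0, pow_zero]
    · exfalso
      have hcop : k.Coprime p :=
        (Nat.coprime_of_lt_prime hk0 hk Fact.out).symm
      have hassoc := hζ.associated_sub_one_pow_sub_one_of_coprime hcop
      rw [hwk, Ideal.span_singleton_pow, Ideal.mem_span_singleton] at hwπ
      have hdvd := hwπ.trans hassoc.symm.dvd
      obtain ⟨e, he⟩ := hdvd
      have h0 : ζ - 1 ≠ 0 := fun h0 => hbot (Ideal.span_singleton_eq_bot.mpr h0)
      refine hprime.ne_top (Ideal.span_singleton_eq_top.mpr (.of_mul_eq_one e ?_))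
      refine mul_left_cancel₀ h0 ?_
      rw [mul_one, ← mul_assoc, ← sq]
      exact he.symm
  · exfalso
    have hwk : w = -ζ ^ k := RingOfIntegers.coe_injective (by rw [map_neg, map_pow]; exact h)
    have h2 : (2 : 𝓞 K) ∈ Ideal.span {ζ - 1} := by
      have h3 := add_mem (Ideal.pow_le_self two_ne_zero hwπ) hζk
      rw [hwk] at h3
      convert! neg_mem h3 using 1
      ring
    have hpm := Ideal.pow_le_self two_ne_zero (natCast_mem_span_sub_one_sq hp hζ)
    obtain ⟨j, hj⟩ := hodd
    rw [hj] at hpm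
    push_cast at hpm
    exact hprime.ne_top ((Ideal.eq_top_iff_one _).mpr
      ((Ideal.add_mem_iff_right _ (Ideal.mul_mem_right _ _ h2)).mp hpm))

end Congruence

/-! ### Complex conjugation and real units -/

section Conjugation

variable {S T : Set ℕ} {hS : ∃ n ∈ S, 2 < n} {hT : ∃ n ∈ T, 2 < n} {K L : Type*} [Field K]
  [NumberField K] [IsCyclotomicExtension S ℚ K] [Field L] [NumberField L]
  [IsCyclotomicExtension T ℚ L]

theorem apply_conj (φ : K →+* ℂ) (x : K) : φ (conj S hS K x) = starRingEnd ℂ (φ x) :=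
  have : IsCMField K := IsCyclotomicExtension.Rat.isCMField K hS
  IsCMField.complexEmbedding_complexConj K φ x

/-- Every complex embedding turns `conj` into conjugation on `ℂ`. With `K = L` this says that `conj`
is central in the Galois group. -/
theorem conj_map (f : K →+* L) (x : K) : conj T hT L (f x) = f (conj S hS K x) := by
  obtain ⟨φ⟩ : Nonempty (L →+* ℂ) := inferInstance
  apply φ.injective
  rw [apply_conj]
  exact (apply_conj (hS := hS) (φ.comp f) x).symm

theorem conj_conj (x : K) : conj S hS K (conj S hS K x) = x :=
  have : IsCMField K := IsCyclotomicExtension.Rat.isCMField K hS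
  IsCMField.complexConj_apply_apply K x

theorem conj_eq_inv {n : ℕ} (hn : n ≠ 0) {x : K} (hx : x ^ n = 1) : conj S hS K x = x⁻¹ := by
  obtain ⟨φ⟩ : Nonempty (K →+* ℂ) := inferInstance
  apply φ.injective
  rw [apply_conj, map_inv₀, Complex.inv_def, Complex.normSq_eq_norm_sq,
    Complex.norm_eq_one_of_pow_eq_one (n := n) (by rw [← map_pow, hx, map_one]) hn]
  simp

/-- Complex conjugation on the ring of integers. -/
def conjInt (S : Set ℕ) (hS : ∃ n ∈ S, 2 < n) (K : Type*) [Field K] [NumberField K]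
    [IsCyclotomicExtension S ℚ K] : 𝓞 K ≃+* 𝓞 K :=
  RingOfIntegers.mapRingEquiv (conj S hS K : K ≃+* K)

theorem coe_conjInt (x : 𝓞 K) : (conjInt S hS K x : K) = conj S hS K (x : K) := rfl

theorem exists_eq_mul_conjInt (u : (𝓞 K)ˣ) :
    ∃ w : 𝓞 K, IsOfFinOrder w ∧ (u : 𝓞 K) = w * conjInt S hS K u := by
  have : IsCMField K := IsCyclotomicExtension.Rat.isCMField K hS
  obtain ⟨w, hw⟩ : ∃ w, w = IsCMField.unitsMulComplexConjInv K u := ⟨_, rfl⟩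
  have hw' := congrArg (fun w : Units.torsion K => (w : (𝓞 K)ˣ)) hw
  simp only [IsCMField.unitsMulComplexConjInv_apply] at hw'
  rw [eq_mul_inv_iff_mul_eq] at hw'
  refine ⟨(w : (𝓞 K)ˣ), ?_, ?_⟩
  · have h : IsOfFinOrder (w : (𝓞 K)ˣ) := (CommGroup.mem_torsion _).mp w.2
    exact (Units.coeHom (𝓞 K)).isOfFinOrder h
  · exact (congrArg Units.val hw').symm

/-- In a CM field `u / ū` is a root of unity `w`. Since `π` is stable under conjugation, `u ≡ ū ≡
-1` gives `w ≡ 1` modulo `π ^ 2`, so `w = 1`. -/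
theorem conjInt_eq_self_of_add_one_mem {p : ℕ} [Fact p.Prime] (hp : 2 < p)
    {hS : ∃ n ∈ ({p} : Set ℕ), 2 < n} [IsCyclotomicExtension {p} ℚ K]
    {ζ : 𝓞 K} (hζ : IsPrimitiveRoot ζ p) (u : (𝓞 K)ˣ)
    (hu : (u : 𝓞 K) + 1 ∈ Ideal.span {ζ - 1} ^ 2) : conjInt {p} hS K u = u := by
  obtain ⟨w, hw, huw⟩ := exists_eq_mul_conjInt (hS := hS) u
  have hcζ : conjInt {p} hS K ζ = ζ ^ (p - 1) := by
    have h1 : (ζ : K) ^ p = 1 := (hζ.map_of_injective RingOfIntegers.coe_injective).pow_eq_one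
    apply RingOfIntegers.ext
    rw [coe_conjInt, conj_eq_inv (n := p) (by omega) h1]
    change (ζ : K)⁻¹ = (ζ : K) ^ (p - 1)
    refine inv_eq_of_mul_eq_one_right ?_
    rw [← pow_succ', Nat.sub_add_cancel (by omega), h1]
  have hcu := ringEquiv_sub_one_mem (conjInt {p} hS K) hcζ hu
  rw [map_add, map_one] at hcu
  have hw1 : w - 1 ∈ Ideal.span {ζ - 1} ^ 2 := by
    have h := sub_mem (Ideal.mul_mem_left _ w hcu) hu
    rwa [mul_add, ← huw, mul_one, add_sub_add_left_eq_sub] at h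
  rw [eq_one_of_isOfFinOrder_of_sub_one_mem hp hζ hw hw1, one_mul] at huw
  exact huw.symm

end Conjugation

/-! ### The real `p`-th root of `A Ā` -/

section RealRoot

theorem algEquiv_pow_apply_root {K : Type*} [Field K] [CharZero K] {σ : K ≃ₐ[ℚ] K} {x : K}
    {v : ℕ} (h : σ x = x ^ v) (i : ℕ) :
    (σ ^ i) x = x ^ v ^ i := by
  induction i with
  | zero => simp
  | succ i ih => rw [pow_succ', AlgEquiv.mul_apply, ih, map_pow, h, ← pow_mul, pow_succ']

theorem exists_algEquiv_pow_eq {K : Type*} [Field K] [CharZero K] {p : ℕ} {σ : K ≃ₐ[ℚ] K}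
    {M : ℕ} {B β : K} (h : σ B = B ^ M * β ^ p)
    (i : ℕ) : ∃ γ, (σ ^ i) B = B ^ M ^ i * γ ^ p := by
  induction i with
  | zero => exact ⟨1, by simp⟩
  | succ i ih =>
    obtain ⟨γ, hγ⟩ := ih
    refine ⟨β ^ M ^ i * σ γ, ?_⟩
    rw [pow_succ', AlgEquiv.mul_apply, hγ, map_mul, map_pow, map_pow, h]
    ring

variable {K : Type*} [Field K] [NumberField K] {p : ℕ} [Fact p.Prime]
  [IsCyclotomicExtension {p} ℚ K] {hS : ∃ n ∈ ({p} : Set ℕ), 2 < n} {ζ : 𝓞 K}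

theorem algEquiv_pow_eq_conj (hζ : IsPrimitiveRoot ζ p) {σ : K ≃ₐ[ℚ] K} {v j : ℕ}
    (hσ : σ (ζ : K) = (ζ : K) ^ v) (hvj : (v : ZMod p) ^ j = -1) (x : K) :
    (σ ^ j) x = conj {p} hS K x := by
  have hζ' : IsPrimitiveRoot (ζ : K) p := hζ.map_of_injective RingOfIntegers.coe_injective
  have hp0 : p ≠ 0 := (Fact.out : p.Prime).ne_zero
  let f : K →ₐ[ℚ] K := (conj {p} hS K : K →+* K).toRatAlgHom
  have h : ((σ ^ j : K ≃ₐ[ℚ] K) : K →ₐ[ℚ] K) = f := by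
    apply (hζ'.powerBasis ℚ).algHom_ext
    rw [IsPrimitiveRoot.powerBasis_gen]
    change (σ ^ j) (ζ : K) = conj {p} hS K (ζ : K)
    rw [algEquiv_pow_apply_root hσ, conj_eq_inv hp0 hζ'.pow_eq_one]
    refine eq_inv_of_mul_eq_one_left ?_
    rw [← pow_succ, ← pow_zero (ζ : K), pow_eq_pow_iff_natCast_eq hζ']
    push_cast
    rw [hvj, neg_add_cancel]
  exact DFunLike.congr_fun h x

/-- An element fixed by conjugation that is a `p`-th power in `K` is the `p`-th power of a real
integer. -/
theorem exists_real_root (hp : 2 < p) (hζ : IsPrimitiveRoot ζ p) {B : 𝓞 K}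
    (hB : conj {p} hS K (B : K) = B) (hB0 : B ≠ 0) {ε : K} (hε : ε ^ p = (B : K)) :
    ∃ D : 𝓞 (maximalRealSubfield K), (B : K) = ((D : maximalRealSubfield K) : K) ^ p := by
  have : IsCMField K := IsCyclotomicExtension.Rat.isCMField K hS
  have hζ' : IsPrimitiveRoot (ζ : K) p := hζ.map_of_injective RingOfIntegers.coe_injective
  have hζ0 : (ζ : K) ≠ 0 := hζ'.ne_zero (by omega)
  have hodd : Odd p := (Fact.out : p.Prime).odd_of_ne_two hp.ne'
  have hε0 : ε ≠ 0 := by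
    rintro rfl
    rw [zero_pow (by omega)] at hε
    exact hB0 (RingOfIntegers.ext hε.symm)
  obtain ⟨k, -, hk⟩ := hζ'.eq_pow_of_pow_eq_one (ξ := conj {p} hS K ε / ε)
    (by rw [div_pow, ← map_pow, hε, hB, div_self]; rw [← hε]; exact pow_ne_zero _ hε0)
  rw [eq_div_iff hε0] at hk
  -- Conjugation multiplies `ε` by `ζ ^ k`. Twisting `ε` by the square root `ζ ^ (k * j)` of `ζ ^ k`
  -- makes it real without changing its `p`-th power.
  obtain ⟨j, hj⟩ : ∃ j, p + 1 = 2 * j := by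
    obtain ⟨l, hl⟩ := hodd
    exact ⟨l + 1, by omega⟩
  have hζj : ((ζ : K) ^ (k * j)) * ((ζ : K) ^ (k * j)) = (ζ : K) ^ k := by
    rw [← pow_add, ← two_mul, show 2 * (k * j) = k * (p + 1) by rw [hj]; ring, mul_add, pow_add,
      mul_one, mul_comm k p, pow_mul, hζ'.pow_eq_one, one_pow, one_mul]
  have hδp : ((ζ : K) ^ (k * j) * ε) ^ p = (B : K) := by
    rw [mul_pow, hε, ← pow_mul, mul_comm (k * j) p, pow_mul, hζ'.pow_eq_one, one_pow, one_mul]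
  have hδ : conj {p} hS K ((ζ : K) ^ (k * j) * ε) = (ζ : K) ^ (k * j) * ε := by
    rw [map_mul, map_pow, conj_eq_inv (n := p) (by omega) hζ'.pow_eq_one, ← hk, ← hζj, inv_pow]
    field_simp
  have hint : IsIntegral ℤ ((ζ : K) ^ (k * j) * ε) :=
    IsIntegral.of_pow (n := p) (by omega) (hδp ▸ B.isIntegral_coe)
  obtain ⟨D, hD⟩ := (IsCMField.RingOfIntegers.complexConj_eq_self_iff K ⟨_, hint⟩).mp hδ
  exact ⟨D, by rw [← hδp]; exact congrArg (· ^ p) hD.symm⟩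

/-- Here `σ ^ j` is complex conjugation, which fixes `B = A Ā`, yet it acts on `B` modulo `p`-th
powers by the exponent `M ^ j ≡ -1`. So `B ^ 2`, and with it `B` since `p` is odd, is a `p`-th
power. -/
theorem exists_mul_conj_eq_pow (hp : 2 < p) (hζ : IsPrimitiveRoot ζ p) {σ : K ≃ₐ[ℚ] K} {v : ℕ}
    (hσ : σ (ζ : K) = (ζ : K) ^ v) {j : ℕ} (hvj : (v : ZMod p) ^ j = -1) {M : ℕ}
    (hM : (M : ZMod p) ^ j = -1) {A : 𝓞 K} (hA0 : A ≠ 0) {α : K}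
    (hAσ : σ (A : K) = (A : K) ^ M * α ^ p) :
    ∃ D : 𝓞 (maximalRealSubfield K),
      (A : K) * conj {p} hS K (A : K) = ((D : maximalRealSubfield K) : K) ^ p := by
  obtain ⟨B, hBdef⟩ : ∃ B : 𝓞 K, B = A * conjInt {p} hS K A := ⟨_, rfl⟩
  have hB0 : B ≠ 0 := by
    rw [hBdef]
    exact mul_ne_zero hA0 ((map_ne_zero_iff _ (conjInt {p} hS K).injective).mpr hA0)
  have hBK : (B : K) = (A : K) * conj {p} hS K (A : K) := by rw [hBdef]; rfl
  have hBK0 : (B : K) ≠ 0 := fun h => hB0 (RingOfIntegers.ext h)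
  have hBc : conj {p} hS K (B : K) = B := by rw [hBK, map_mul, conj_conj, mul_comm]
  rw [← hBK]
  have hBσ : σ (B : K) = (B : K) ^ M * (α * conj {p} hS K α) ^ p := by
    have h : σ (conj {p} hS K (A : K)) = conj {p} hS K (σ (A : K)) :=
      (conj_map (hS := hS) (hT := hS) (σ : K →+* K) (A : K)).symm
    rw [hBK, map_mul, h, hAσ, map_mul, map_pow, map_pow]
    ring
  obtain ⟨γ, hγ⟩ := exists_algEquiv_pow_eq hBσ j
  rw [algEquiv_pow_eq_conj (hS := hS) hζ hσ hvj, hBc] at hγ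
  obtain ⟨l, hl⟩ : p ∣ M ^ j + 1 := by
    rw [← ZMod.natCast_eq_zero_iff]
    push_cast
    rw [hM, neg_add_cancel]
  have hsq : (B : K) ^ 2 = ((B : K) ^ l * γ) ^ p := by
    rw [mul_pow, ← pow_mul, mul_comm l p, ← hl, pow_succ _ (M ^ j), mul_right_comm, ← hγ, sq]
  obtain ⟨i, hi⟩ := (Fact.out : p.Prime).odd_of_ne_two hp.ne'
  -- With `p = 2 i + 1`, `B = B ^ p / (B ^ 2) ^ i`.
  refine exists_real_root (hS := hS) hp hζ hBc hB0 (ε := (B : K) / ((B : K) ^ l * γ) ^ i) ?_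
  rw [div_pow, ← pow_mul, mul_comm i p, pow_mul, ← hsq, ← pow_mul, div_eq_iff (pow_ne_zero _ hBK0),
    ← pow_succ', hi]

end RealRoot

/-! ### Exponentiation by the Stickelberger element -/

section GroupRing

/-- Additivity of exponents suffices, so the powers `σ ^ i` need not be known to be distinct. -/
theorem groupRingPow_stickelbergerP {K : Type*} [Field K] [CharZero K] (p v : ℕ) (σ : K ≃ₐ[ℚ] K)
    {x : K} (hx : x ≠ 0) : groupRingPow x (stickelbergerP p v σ) =
      ∏ i ∈ Finset.range (p - 1), (σ ^ i) x ^ ((v : ZMod p)⁻¹ ^ i).val := by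
  rw [groupRingPow, stickelbergerP, MonoidAlgebra.coeff_sum, ← Finsupp.prod_finsetSum_index]
  · refine Finset.prod_congr rfl fun i _ => ?_
    rw [MonoidAlgebra.coeff_single, Finsupp.prod_single_index (by simp), zpow_natCast]
  · exact fun g => zpow_zero _
  · exact fun g m n => zpow_add₀ ((map_ne_zero g).mpr hx) m n

end GroupRing

/-! ### The Gauss sum as a sum over characters -/

section GaussSum

variable {K : Type*} [Field K]

/-- The additive character `x ↦ ζ_q ^ Tr(x)` of the residue field. -/
def residueAddChar (q : ℕ) [NeZero q] (𝔮 : Ideal (𝓞 K)) [𝔮.LiesOver (Ideal.span {(q : ℤ)})]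
    {L : Type*} [Field L] {ζq : L} (hζq : ζq ^ q = 1) : AddChar (𝓞 K ⧸ 𝔮) L :=
  (AddChar.zmodChar q hζq).compAddMonoidHom
    { toFun := residueTrace q 𝔮
      map_zero' := by rw [residueTrace, map_zero, map_zero]
      map_add' := fun x y => by rw [residueTrace, map_add, map_add]; rfl }

theorem residueAddChar_apply (q : ℕ) [NeZero q] (𝔮 : Ideal (𝓞 K))
    [𝔮.LiesOver (Ideal.span {(q : ℤ)})] {L : Type*} [Field L] {ζq : L} (hζq : ζq ^ q = 1)
    (x : 𝓞 K ⧸ 𝔮) : residueAddChar q 𝔮 hζq x = ζq ^ (residueTrace q 𝔮 x).val := rfl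

variable [NumberField K]

theorem powerResidue_eq {p q d : ℕ} [NeZero p] {ζ : 𝓞 K} (hζ : IsPrimitiveRoot ζ p)
    {𝔮 : Ideal (𝓞 K)} (hN : Ideal.absNorm 𝔮 = q) (hpd : p * d = q - 1)
    (hζ𝔮 : IsPrimitiveRoot (Ideal.Quotient.mk 𝔮 ζ) p) {χ : MulChar (𝓞 K ⧸ 𝔮) (𝓞 K)}
    (hχ0 : χ 0 = 0) (hχ : ∀ x, Ideal.Quotient.mk 𝔮 (χ x) = x ^ d)
    (hχζ : ∀ x, x ≠ 0 → ∃ c : ℕ, χ x = ζ ^ c) (x : 𝓞 K ⧸ 𝔮) :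
    powerResidue p ζ 𝔮 x = χ x := by
  classical
  have hd : (Ideal.absNorm 𝔮 - 1) / p = d := by
    rw [hN, ← hpd, Nat.mul_div_cancel_left _ (NeZero.pos p)]
  by_cases hx : x = 0
  · rw [powerResidue, dif_neg (fun h => h.1 hx), hx, hχ0]
  · obtain ⟨c, hc⟩ := hχζ x hx
    have hex : ∃ c : ℕ, x ^ ((Ideal.absNorm 𝔮 - 1) / p) = Ideal.Quotient.mk 𝔮 (ζ ^ c) :=
      ⟨c, by rw [hd, ← hχ, hc]⟩
    rw [powerResidue, dif_pos ⟨hx, hex⟩, hc]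
    -- The exponent from `Nat.find` may differ from `c`, but the two roots of unity agree modulo
    -- `𝔮`.
    refine pow_eq_pow_of_map_eq (Ideal.Quotient.mk 𝔮) hζ hζ𝔮 ?_
    refine (map_pow _ _ _).symm.trans ((Nat.find_spec hex).symm.trans ?_)
    rw [hd, ← hχ, hc, map_pow]

theorem exists_residueTrace_eq_one (q : ℕ) [Fact q.Prime] (𝔮 : Ideal (𝓞 K)) [𝔮.IsMaximal]
    [𝔮.LiesOver (Ideal.span {(q : ℤ)})] : ∃ x, residueTrace q 𝔮 x = 1 := by
  let e := Int.quotientSpanNatEquivZMod q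
  have : (Ideal.span {(q : ℤ)}).IsMaximal :=
    Int.ideal_span_isMaximal_of_prime q
  let := Ideal.Quotient.field (Ideal.span {(q : ℤ)})
  let := Ideal.Quotient.field 𝔮
  have : Finite (ℤ ⧸ Ideal.span {(q : ℤ)}) := Finite.of_equiv _ e.symm.toEquiv
  have : FiniteDimensional (ℤ ⧸ Ideal.span {(q : ℤ)}) (𝓞 K ⧸ 𝔮) := inferInstance
  obtain ⟨x, hx⟩ := Algebra.trace_surjective (ℤ ⧸ Ideal.span {(q : ℤ)}) (𝓞 K ⧸ 𝔮) 1
  refine ⟨x, ?_⟩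
  rw [residueTrace]
  exact (congrArg e hx).trans (map_one e)

theorem residueAddChar_ne_one (q : ℕ) [Fact q.Prime] (𝔮 : Ideal (𝓞 K)) [𝔮.IsMaximal]
    [𝔮.LiesOver (Ideal.span {(q : ℤ)})] {L : Type*} [Field L] {ζq : L}
    (hζq : IsPrimitiveRoot ζq q) : residueAddChar q 𝔮 hζq.pow_eq_one ≠ 1 := by
  obtain ⟨x, hx⟩ := exists_residueTrace_eq_one q 𝔮
  intro h
  have h1 := DFunLike.congr_fun h x
  have hq := (Fact.out : q.Prime).one_lt
  have : Fact (1 < q) := ⟨hq⟩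
  rw [residueAddChar_apply, hx, AddChar.one_apply, ZMod.val_one, pow_one] at h1
  exact hζq.ne_one hq h1

theorem gaussSumAt_eq_gaussSum {p q : ℕ} [NeZero q] {ζ : 𝓞 K} {𝔮 : Ideal (𝓞 K)} [𝔮.IsMaximal]
    [𝔮.LiesOver (Ideal.span {(q : ℤ)})] [Fintype (𝓞 K ⧸ 𝔮)] {L : Type*} [Field L] [Algebra K L]
    {ζq : L} (hζq : ζq ^ q = 1) {χ : MulChar (𝓞 K ⧸ 𝔮) (𝓞 K)}
    (hχ : ∀ x, powerResidue p ζ 𝔮 x = χ x) :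
    gaussSumAt p q ζ ζq 𝔮 = gaussSum
      (χ⁻¹.ringHomComp ((algebraMap K L).comp (algebraMap (𝓞 K) K))) (residueAddChar q 𝔮 hζq) := by
  let := Ideal.Quotient.field 𝔮
  rw [gaussSumAt, finsum_eq_sum_of_fintype, gaussSum]
  refine Finset.sum_congr rfl fun x _ => ?_
  have h := MulChar.ringHomComp_inv χ ((algebraMap K L).comp (algebraMap (𝓞 K) K))
  rw [residueAddChar_apply, hχ, ← h, MulChar.inv_apply_eq_inv']
  rfl

/-- A field automorphism inverting the values of both characters turns a Gauss sum into the Gauss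
sum of the inverse characters. -/
theorem map_gaussSum_eq_inv {F L : Type*} [Field F] [Fintype F] [Field L] (c : L →+* L)
    (φ : MulChar F L) (ψ : AddChar F L) (hφ : ∀ x, x ≠ 0 → c (φ x) = (φ x)⁻¹)
    (hψ : ∀ x, c (ψ x) = (ψ x)⁻¹) : c (gaussSum φ ψ) = gaussSum φ⁻¹ ψ⁻¹ := by
  rw [gaussSum, gaussSum, map_sum]
  refine Finset.sum_congr rfl fun x _ => ?_
  rw [map_mul, hψ, MulChar.inv_apply_eq_inv', AddChar.inv_apply, AddChar.map_neg_eq_inv]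
  by_cases hx : x = 0
  · rw [hx, MulChar.map_zero, map_zero, inv_zero]
  · rw [hφ x hx]

end GaussSum

/-! ### The Stickelberger relation and the theorem -/

section Main

theorem jacobiProd_inv_add_one_mem {p : ℕ} [Fact p.Prime] (hp : 2 < p) {K : Type*} [Field K]
    {ζ : 𝓞 K} (hζ : IsPrimitiveRoot ζ p) {F : Type*} [Field F] [Fintype F] {q : ℕ} [Fact q.Prime]
    (hcard : Fintype.card F = q) (hpq : p ∣ q - 1) {χ : MulChar F (𝓞 K)}
    (hχζ : ∀ x, x ≠ 0 → ∃ c : ℕ, χ x = ζ ^ c) : jacobiProd p χ⁻¹ + 1 ∈ Ideal.span {ζ - 1} := by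
  obtain ⟨d, hpd⟩ := hpq
  have h := map_jacobiProd_eq_neg_one (Ideal.Quotient.mk (Ideal.span {ζ - 1}))
    ((Fact.out : p.Prime).odd_of_ne_two hp.ne') hp (φ := χ⁻¹) ?_ ?_
  · rw [← Ideal.Quotient.eq_zero_iff_mem, map_add, h, map_one, neg_add_cancel]
  · intro x hx
    obtain ⟨c, hc⟩ := residueChar_inv_apply hχζ x hx
    rw [hc, ← map_one (Ideal.Quotient.mk _), Ideal.Quotient.eq, Ideal.mem_span_singleton]
    exact sub_one_dvd_pow_sub_one ζ c
  · have h1 : (q : 𝓞 K) - 1 ∈ Ideal.span {ζ - 1} := by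
      have hpm := Ideal.pow_le_self two_ne_zero (natCast_mem_span_sub_one_sq hp hζ)
      have h2 := Ideal.mul_mem_right (d : 𝓞 K) _ hpm
      rwa [← Nat.cast_mul, ← hpd, Nat.cast_sub (Fact.out : q.Prime).one_le, Nat.cast_one] at h2
    rw [← Ideal.Quotient.eq, map_natCast, map_one] at h1
    rw [hcard, h1]

theorem add_one_mem_of_eq_prod_mul {R ι : Type*} [CommRing R] {I : Ideal R} {s : Finset ι}
    {x : ι → R} {t : ι → ℕ} {G u : R} (hG : G + 1 ∈ I) (h : G = (∏ i ∈ s, x i ^ t i) * u)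
    (hx : ∀ i ∈ s, x i - 1 ∈ I) : u + 1 ∈ I := by
  rw [h, ← Ideal.Quotient.eq_zero_iff_mem, map_add, map_mul, map_prod,
    Finset.prod_eq_one, one_mul] at hG
  · rwa [← Ideal.Quotient.eq_zero_iff_mem, map_add]
  · intro i hi
    have h1 := hx i hi
    rw [← Ideal.Quotient.eq, map_one] at h1
    rw [map_pow, h1, one_pow]

variable {p : ℕ} [Fact p.Prime] {K : Type*} [Field K] [NumberField K]
  [IsCyclotomicExtension {p} ℚ K] {ζ : 𝓞 K}

/-- The `p`-th power of the Gauss sum, as an integer of `K`, with its ideal factorization and its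
absolute value. -/
theorem exists_gaussSum_pow (hp : 2 < p) (hζ : IsPrimitiveRoot ζ p)
    {hS : ∃ n ∈ ({p} : Set ℕ), 2 < n}
    {v : ℕ} (hv : IsPrimitiveRoot (v : ZMod p) (p - 1)) {σ : K ≃ₐ[ℚ] K}
    (hσ : σ (ζ : K) = (ζ : K) ^ v) {q : ℕ} [Fact q.Prime] (hq : q ≡ 1 [MOD p])
    (𝔮 : Ideal (𝓞 K)) [𝔮.IsPrime] [𝔮.LiesOver (Ideal.span {(q : ℤ)})]
    (hN : Ideal.absNorm 𝔮 = q) {A : 𝓞 K} (hA : Ideal.span {A} = 𝔮 ^ p)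
    (hA1 : A - 1 ∈ Ideal.span {ζ - 1} ^ 2)
    {L : Type*} [Field L] [NumberField L] {T : Set ℕ} {hT : ∃ n ∈ T, 2 < n}
    [IsCyclotomicExtension T ℚ L] [Algebra K L] (ζq : L) (hζq : IsPrimitiveRoot ζq q) :
    ∃ G : 𝓞 K, algebraMap K L G = gaussSumAt p q ζ ζq 𝔮 ^ p ∧ ∃ u : (𝓞 K)ˣ,
      G ^ p = (∏ i ∈ Finset.range (p - 1),
        RingOfIntegers.mapRingEquiv (σ ^ i : K ≃ₐ[ℚ] K).toRingEquiv A ^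
          ((v : ZMod p)⁻¹ ^ i).val) * u ∧ conjInt {p} hS K u = u := by
  have hpp : p.Prime := Fact.out
  have hqp : q.Prime := Fact.out
  obtain ⟨d, hpd⟩ : p ∣ q - 1 := (Nat.modEq_iff_dvd' hqp.one_le).mp hq.symm
  have hpd : p * d = q - 1 := hpd.symm
  have hd : 0 < d := by
    rw [Nat.pos_iff_ne_zero]
    rintro rfl
    have := hqp.one_lt
    omega
  have hcop : q.Coprime p := by
    refine (Nat.coprime_primes hqp hpp).mpr ?_
    rintro rfl
    have : q ≤ q - 1 := hpd ▸ Nat.le_mul_of_pos_right q hd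
    omega
  have h𝔮0 : 𝔮 ≠ ⊥ := by
    rintro rfl
    rw [Ideal.absNorm_bot] at hN
    exact hqp.ne_zero hN.symm
  have hmax : 𝔮.IsMaximal := Ring.DimensionLEOne.maximalOfPrime h𝔮0 inferInstance
  have hζ𝔮 : IsPrimitiveRoot (Ideal.Quotient.mk 𝔮 ζ) p :=
    hζ.idealQuotient_mk (hN ▸ hqp.ne_one) (hN ▸ hcop)
  let := Ideal.Quotient.field 𝔮
  let : Fintype (𝓞 K ⧸ 𝔮) := Fintype.ofFinite _
  have hcard : Fintype.card (𝓞 K ⧸ 𝔮) = q := by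
    rw [← Nat.card_eq_fintype_card, ← hN, Ideal.absNorm_apply]
    rfl
  obtain ⟨χ, hχ, hχζ⟩ := exists_residueChar (Ideal.Quotient.mk 𝔮) hζ hζ𝔮 hd (hcard ▸ hpd)
  have hord : orderOf χ⁻¹ = p := orderOf_residueChar_inv (Ideal.Quotient.mk 𝔮) hχ
    (residueChar_pow_eq_one hζ hχζ) hd (hcard ▸ hpd)
  set f := (algebraMap K L).comp (algebraMap (𝓞 K) K) with hf
  have hfinj : Function.Injective f := (algebraMap K L).injective.comp RingOfIntegers.coe_injective
  have hψ : (residueAddChar q 𝔮 hζq.pow_eq_one).IsPrimitive :=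
    AddChar.IsPrimitive.of_ne_one (residueAddChar_ne_one q 𝔮 hζq)
  have hg := gaussSumAt_eq_gaussSum (p := p) hζq.pow_eq_one
    (powerResidue_eq hζ hN hpd hζ𝔮 (MulChar.map_zero χ) hχ hχζ)
  have hGg := gaussSum_pow_eq_map_jacobiProd hfinj hpp.two_le hord hψ
  have hinvne : χ⁻¹.ringHomComp f ≠ 1 := by
    rw [MulChar.ringHomComp_ne_one_iff hfinj]
    intro h
    rw [h, orderOf_one] at hord
    exact hpp.ne_one hord.symm
  -- Conjugation inverts both characters, so this is the classical `g(χ) g(χ⁻¹)` identity; its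
  -- `p`-th power descends to `K` as `hGc`.
  have hconj : conj T hT L (gaussSumAt p q ζ ζq 𝔮) * gaussSumAt p q ζ ζq 𝔮 = q := by
    rw [hg]
    have h := map_gaussSum_eq_inv (conj T hT L : L →+* L) (χ⁻¹.ringHomComp f)
      (residueAddChar q 𝔮 hζq.pow_eq_one) ?_ ?_
    · refine (congrArg (· * _) h).trans ?_
      rw [mul_comm, gaussSum_mul_gaussSum_eq_card hinvne hψ, hcard]
    · intro x hx
      refine conj_eq_inv (n := p) hpp.ne_zero ?_
      obtain ⟨c, hc⟩ := residueChar_inv_apply hχζ x hx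
      rw [MulChar.ringHomComp_apply, hc, ← map_pow, ← pow_mul, mul_comm, pow_mul, hζ.pow_eq_one,
        one_pow, map_one]
    · intro x
      refine conj_eq_inv (n := q) hqp.ne_zero ?_
      rw [residueAddChar_apply, ← pow_mul, mul_comm, pow_mul, hζq.pow_eq_one, one_pow]
  have hGc : jacobiProd p χ⁻¹ * conjInt {p} hS K (jacobiProd p χ⁻¹) = (q : 𝓞 K) ^ p := by
    apply hfinj
    have h : f (conjInt {p} hS K (jacobiProd p χ⁻¹)) = conj T hT L (f (jacobiProd p χ⁻¹)) :=
      (conj_map (hS := hS) (algebraMap K L) _).symm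
    rw [map_mul, h, ← hGg, ← hg, map_pow, ← mul_pow, mul_comm, hconj, map_pow, map_natCast]
  have hker : RingHom.ker (Ideal.Quotient.mk 𝔮) = 𝔮 := Ideal.mk_ker
  have hmax' : (RingHom.ker (Ideal.Quotient.mk 𝔮)).IsMaximal := hker.symm ▸ hmax
  have hτ : ∀ i, RingOfIntegers.mapRingEquiv (σ ^ i : K ≃ₐ[ℚ] K).toRingEquiv ζ = ζ ^ v ^ i :=
    fun i => RingOfIntegers.ext (algEquiv_pow_apply_root hσ i)
  obtain ⟨u, hu⟩ := exists_unit_jacobiProd_pow hp hζ hv hτ hqp (Ideal.Quotient.mk 𝔮) hcard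
    (hker.symm ▸ hN) (hker.symm ▸ hζ𝔮) hχ hχζ hd hpd (hker.symm ▸ hA) (conjInt {p} hS K) hGc
  refine ⟨jacobiProd p χ⁻¹, ?_, u, hu, conjInt_eq_self_of_add_one_mem hp hζ u ?_⟩
  · rw [hg, hGg]
    rfl
  have hodd : Odd p := hpp.odd_of_ne_two hp.ne'
  have hG1 := jacobiProd_inv_add_one_mem hp hζ hcard ⟨d, hpd.symm⟩ hχζ
  have hGp := pow_add_one_mem hp hodd hζ hG1
  refine add_one_mem_of_eq_prod_mul hGp hu fun i _ => ?_
  have h := ringEquiv_sub_one_mem _ (hτ i) hA1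
  rwa [map_sub, map_one] at h

end Main

theorem pow_half_eq_neg_one {p v : ℕ} [Fact p.Prime] (hp : 2 < p)
    (hv : IsPrimitiveRoot (v : ZMod p) (p - 1)) : (v : ZMod p) ^ ((p - 1) / 2) = -1 := by
  obtain ⟨k, hk⟩ := (Fact.out : p.Prime).odd_of_ne_two hp.ne'
  exact (hv.pow (by omega) (show p - 1 = (p - 1) / 2 * 2 by omega)).eq_neg_one_of_two_right

/-- The Stickelberger relation for the quotient of the Gauss sum by its complex conjugate. -/
theorem gaussSumAt_div_conj_pow {p : ℕ} [Fact p.Prime] (hp : 2 < p) {K : Type*} [Field K]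
    [NumberField K] [IsCyclotomicExtension {p} ℚ K] {ζ : 𝓞 K} (hζ : IsPrimitiveRoot ζ p)
    {hS : ∃ n ∈ ({p} : Set ℕ), 2 < n}
    {v : ℕ} (hv : IsPrimitiveRoot (v : ZMod p) (p - 1)) {σ : K ≃ₐ[ℚ] K}
    (hσ : σ (ζ : K) = (ζ : K) ^ v) {q : ℕ} [Fact q.Prime] (hq : q ≡ 1 [MOD p])
    (𝔮 : Ideal (𝓞 K)) [𝔮.IsPrime] [𝔮.LiesOver (Ideal.span {(q : ℤ)})]
    (hN : Ideal.absNorm 𝔮 = q) {A : 𝓞 K} (hA0 : A ≠ 0) (hA : Ideal.span {A} = 𝔮 ^ p)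
    (hA1 : A - 1 ∈ Ideal.span {ζ - 1} ^ 2)
    {L : Type*} [Field L] [NumberField L] {T : Set ℕ} {hT : ∃ n ∈ T, 2 < n}
    [IsCyclotomicExtension T ℚ L] [Algebra K L] (ζq : L) (hζq : IsPrimitiveRoot ζq q) :
    (gaussSumAt p q ζ ζq 𝔮 / conj T hT L (gaussSumAt p q ζ ζq 𝔮)) ^ (p ^ 2) =
      algebraMap K L (groupRingPow ((A : K) / conj {p} hS K (A : K)) (stickelbergerP p v σ)) := by
  obtain ⟨G, hG, u, hGu, hu⟩ :=
    exists_gaussSum_pow (hS := hS) (hT := hT) hp hζ hv hσ hq 𝔮 hN hA hA1 ζq hζq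
  have hAK : (A : K) ≠ 0 := fun h => hA0 (RingOfIntegers.ext h)
  rw [groupRingPow_stickelbergerP p v σ (div_ne_zero hAK ((map_ne_zero _).mpr hAK)), sq, pow_mul,
    div_pow, ← map_pow, ← hG]
  have h1 : conj T hT L (algebraMap K L G) = algebraMap K L (conj {p} hS K (G : K)) :=
    conj_map (hS := hS) (algebraMap K L) (G : K)
  rw [h1, ← map_div₀, ← map_pow, div_pow,
    ← map_pow (conj {p} hS K) (G : K)]
  congr 1
  have h2 : (G : K) ^ p = (∏ i ∈ Finset.range (p - 1),
      (σ ^ i) (A : K) ^ ((v : ZMod p)⁻¹ ^ i).val) * (u : 𝓞 K) := by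
    have h := congrArg (algebraMap (𝓞 K) K) hGu
    rw [map_pow, map_mul, map_prod] at h
    simp only [map_pow] at h
    exact h
  have hu0 : ((u : 𝓞 K) : K) ≠ 0 := fun h => u.ne_zero (RingOfIntegers.ext h)
  have hcu : conj {p} hS K ((u : 𝓞 K) : K) = (u : 𝓞 K) := congrArg (algebraMap (𝓞 K) K) hu
  -- The unit is real, so it cancels between numerator and denominator.
  rw [h2, map_mul, hcu, mul_div_mul_right _ _ hu0, map_prod, ← Finset.prod_div_distrib]
  refine Finset.prod_congr rfl fun i _ => ?_
  have h3 : conj {p} hS K ((σ ^ i) (A : K)) = (σ ^ i) (conj {p} hS K (A : K)) :=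
    conj_map (hS := hS) (hT := hS) ((σ ^ i : K ≃ₐ[ℚ] K) : K →+* K) (A : K)
  rw [map_pow, h3, ← div_pow, map_div₀]

end StickelbergerSingular

end

theorem theoreml512163
    -- the odd prime `p`, the field `K = ℚ(ζ_p)`, and the prime `π = (ζ_p - 1)`
    (p : ℕ) [Fact p.Prime] (hp : 2 < p)
    {K : Type*} [Field K] [NumberField K] [IsCyclotomicExtension {p} ℚ K]
    (ζ : 𝓞 K) (hζ : IsPrimitiveRoot ζ p)
    (π : Ideal (𝓞 K)) (hπ : π = Ideal.span {ζ - 1})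
    -- `p` is irregular and does not divide the class number of `K⁺`
    (hirr : p ∣ classNumber K) (hplus : ¬ p ∣ classNumber (maximalRealSubfield K))
    -- the primitive root `v` modulo `p` and the automorphism `σ : ζ_p ↦ ζ_p ^ v`
    (v : ℕ) (hv : IsPrimitiveRoot (v : ZMod p) (p - 1))
    (σ : K ≃ₐ[ℚ] K) (hσ : σ (ζ : K) = (ζ : K) ^ v)
    -- the subgroup `Γ` of order `p` of the `p`-class group, annihilated by `σ - μ`
    (Γ : Subgroup (ClassGroup (𝓞 K)))
    (hΓp : Γ ≤ CommGroup.primaryComponent (ClassGroup (𝓞 K)) p) (hΓ : Nat.card Γ = p)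
    (μ : ZMod p) (m : ℕ) (hm : 1 ≤ m) (hmp : 2 * m + 3 ≤ p) (hμ : μ = (v : ZMod p) ^ (2 * m + 1))
    (hΓσ : StickelbergerSingular.AnnihilatedBy σ μ Γ)
    -- the prime ideal `𝔮` over `q`, of residue degree one, with class in `Γ`
    (q : ℕ) [Fact q.Prime] (hq : q ≡ 1 [MOD p])
    (𝔮 : Ideal (𝓞 K)) [𝔮.IsPrime] [𝔮.LiesOver (Ideal.span {(q : ℤ)})]
    (h𝔮 : 𝔮 ∈ (Ideal (𝓞 K))⁰) (hN : Ideal.absNorm 𝔮 = q) (h𝔮Γ : ClassGroup.mk0 ⟨𝔮, h𝔮⟩ ∈ Γ)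
    -- the singular integer `A`
    (A : 𝓞 K) (hA : StickelbergerSingular.IsSingular p A) (hA𝔮 : Ideal.span {A} = 𝔮 ^ p)
    (hAσ : ∃ α : K, σ (A : K) = (A : K) ^ μ.val * α ^ p)
    (hAπ : A - 1 ∈ π ^ (2 * m + 1)) (hAπ' : A - 1 ∉ π ^ (2 * m + 2))
    -- the field `L = ℚ(ζ_p, ζ_q)` and the root of unity `ζ_q`
    {L : Type*} [Field L] [NumberField L] [IsCyclotomicExtension {p, q} ℚ L] [Algebra K L]
    (ζq : L) (hζq : IsPrimitiveRoot ζq q) :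
    (∃ D : 𝓞 (maximalRealSubfield K),
      (A : K) * StickelbergerSingular.conj {p} ⟨p, rfl, hp⟩ K (A : K) =
        ((D : maximalRealSubfield K) : K) ^ p) ∧
    ∀ D : 𝓞 (maximalRealSubfield K),
      (A : K) * StickelbergerSingular.conj {p} ⟨p, rfl, hp⟩ K (A : K) =
        ((D : maximalRealSubfield K) : K) ^ p →
      (StickelbergerSingular.gaussSumAt p q ζ ζq 𝔮 /
        StickelbergerSingular.conj {p, q} ⟨p, Or.inl rfl, hp⟩ L
          (StickelbergerSingular.gaussSumAt p q ζ ζq 𝔮)) ^ (p ^ 2) =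
      algebraMap K L (StickelbergerSingular.groupRingPow
        ((A : K) ^ 2 / ((D : maximalRealSubfield K) : K) ^ p)
        (StickelbergerSingular.stickelbergerP p v σ)) := by
  have hA0 : A ≠ 0 := by
    rintro rfl
    exact hA.1 ⟨0, (zero_pow (by omega)).trans rfl⟩
  have hvhalf := StickelbergerSingular.pow_half_eq_neg_one hp hv
  have hM : ((μ.val : ℕ) : ZMod p) ^ ((p - 1) / 2) = -1 := by
    -- The oddness of `2 * m + 1` enters here: `(-1) ^ (2 * m + 1) = -1`.
    rw [ZMod.natCast_zmod_val, hμ, ← pow_mul, mul_comm, pow_mul, hvhalf,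
      Odd.neg_one_pow ⟨m, rfl⟩]
  obtain ⟨α, hα⟩ := hAσ
  refine ⟨StickelbergerSingular.exists_mul_conj_eq_pow hp hζ hσ hvhalf hM hA0 hα, fun D hD => ?_⟩
  have hAK : (A : K) ≠ 0 := fun h => hA0 (RingOfIntegers.ext h)
  have hdiv : (A : K) ^ 2 / ((D : maximalRealSubfield K) : K) ^ p =
      (A : K) / StickelbergerSingular.conj {p} ⟨p, rfl, hp⟩ K (A : K) := by
    rw [← hD, sq (A : K), mul_div_mul_left _ _ hAK]
  rw [hdiv]
  -- Only `A ≡ 1` modulo `π ^ 2` is needed, and `2 * m + 1 ≥ 2`.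
  exact StickelbergerSingular.gaussSumAt_div_conj_pow hp hζ hv hσ hq 𝔮 hN hA0 hA𝔮
    (Ideal.pow_le_pow_right (by omega) (hπ ▸ hAπ)) ζq hζq
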